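/- Let $d\in\mathbb N$, let $F:\mathbb R^d\to\mathbb R$ be differentiable, and let $f$ be a random (almost surely differentiable) function $\mathbb R^d\to\mathbb R$ with $\mathbb E[\nabla f(x)]=\nabla F(x)$ for all $x\in\mathbb R^d$; let $f_1,f_2,\dots$ be i.i.d. copies of $f$. Let $\epsilon>0$, $R\ge\sqrt\epsilon$, $L$ and $F_*$ be real numbers such that for all $x,y\in\mathbb R^d$: $F(x)\ge F_*$; $\ \|\nabla f(x)\|_\infty\le R-\sqrt\epsilon$ almost surely; and $\ \|\nabla F(x)-\nabla F(y)\|_2\le L\|x-y\|_2$. Consider Adagrad with heavy-ball momentum $0\le\beta_1<1$ and constant step size $(1-\beta_1)\alpha$, where $\alpha>0$: given a deterministic $x_0\in\mathbb R^d$ and $m_0=v_0=0$, for all $n\ge1$ and all coordinates $i$, $$m_{n,i}=\beta_1 m_{n-1,i}+\nabla_i f_n(x_{n-1}),\qquad v_{n,i}=v_{n-1,i}+(\nabla_i f_n(x_{n-1}))^2,\qquad x_{n,i}=x_{n-1,i}-(1-\beta_1)\alpha\,\frac{m_{n,i}}{\sqrt{\epsilon+v_{n,i}}}.$$ Let $N$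 be a positive integer with $N>\frac{\beta_1}{1-\beta_1}$, and let $\tau$ be a random index in $\{0,\dots,N-1\}$, independent of $(f_n)_{n\ge1}$, with $\mathbb P(\tau=j)\propto 1-\beta_1^{N-j}$. Then $$\mathbb E\big[\|\nabla F(x_\tau)\|_2^2\big]\le 2R\sqrt N\,\frac{F(x_0)-F_*}{\alpha\tilde N}+\frac{\sqrt N}{\tilde N}\,C\,\ln\Big(1+\frac{NR^2}{\epsilon}\Big),$$ where $$\tilde N=N-\frac{\beta_1}{1-\beta_1},\qquad C=\alpha dRL+\frac{12dR^2}{1-\beta_1}+\frac{2\alpha^2dL^2\beta_1}{1-\beta_1}.$$ In particular $C\le(\alpha dRL+12dR^2+2\alpha^2dL^2)/(1-\beta_1)$, i.e. $C=O((1-\beta_1)^{-1})$ as a function of $\beta_1$. -/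

import Mathlib

open MeasureTheory ProbabilityTheory

/-- The three vectors `m`, `v`, `x` of `ℝᵈ` maintained by the adaptive method. -/
structure AdaState (d : ℕ) where
  /-- heavy-ball accumulator of past gradients -/
  m : EuclideanSpace ℝ (Fin d)
  /-- accumulator of past squared gradients, coordinate by coordinate -/
  v : EuclideanSpace ℝ (Fin d)
  /-- current iterate -/
  x : EuclideanSpace ℝ (Fin d)

/-- One update from a state `s` with stochastic gradient `g` (taken at `s.x`) and step size `a`:
`mᵢ ← β₁ mᵢ + gᵢ`, `vᵢ ← β₂ vᵢ + gᵢ²`, `xᵢ ← xᵢ - a mᵢ / √(ε + vᵢ)`, where the last update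
uses the new values of `m` and `v`. -/
noncomputable def AdaState.step {d : ℕ} (β₁ β₂ ε a : ℝ) (s : AdaState d)
    (g : EuclideanSpace ℝ (Fin d)) : AdaState d :=
  let m' : EuclideanSpace ℝ (Fin d) := WithLp.toLp 2 fun i => β₁ * s.m i + g i
  let v' : EuclideanSpace ℝ (Fin d) := WithLp.toLp 2 fun i => β₂ * s.v i + (g i) ^ 2
  { m := m'
    v := v'
    x := WithLp.toLp 2 fun i => s.x i - a * (m' i / Real.sqrt (ε + v' i)) }

/-- The state `(mₙ, vₙ, xₙ)` after `n` iterations from `m₀ = 0`, `v₀ = 0` and `x₀`, along the sequence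
`h 0, h 1, …` of sampled objective functions (`h n` is the sample used by iteration `n + 1`), with
step size `a n` at iteration `n` (`n ≥ 1`). -/
noncomputable def adaState {d : ℕ} (β₁ β₂ ε : ℝ) (a : ℕ → ℝ)
    (h : ℕ → EuclideanSpace ℝ (Fin d) → ℝ) (x₀ : EuclideanSpace ℝ (Fin d)) : ℕ → AdaState d
  | 0 => { m := 0, v := 0, x := x₀ }
  | n + 1 =>
      let s := adaState β₁ β₂ ε a h x₀ n
      s.step β₁ β₂ ε (a (n + 1)) (gradient (h n) s.x)

/-- The iterate `xₙ` of Adagrad (`β₂ = 1`) with heavy-ball momentum `β₁` and constant step size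
`(1 - β₁) α`. -/
noncomputable def adagradIterate {d : ℕ} (β₁ ε α : ℝ)
    (h : ℕ → EuclideanSpace ℝ (Fin d) → ℝ) (x₀ : EuclideanSpace ℝ (Fin d)) (n : ℕ) :
    EuclideanSpace ℝ (Fin d) :=
  (adaState β₁ 1 ε (fun _ => (1 - β₁) * α) h x₀ n).x

/-- `Ñ = N - β₁ / (1 - β₁)`. -/
noncomputable def effectiveIterations (N : ℕ) (β₁ : ℝ) : ℝ := (N : ℝ) - β₁ / (1 - β₁)

/-- `C = α d R L + 12 d R² / (1 - β₁) + 2 α² d L² β₁ / (1 - β₁)`. -/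
noncomputable def adagradConst (d : ℕ) (α R L β₁ : ℝ) : ℝ :=
  α * d * R * L + 12 * d * R ^ 2 / (1 - β₁) + 2 * α ^ 2 * d * L ^ 2 * β₁ / (1 - β₁)

/-!
The bound is obtained along each trajectory first, and expectations are taken only at the end.

Write `x n` for the iterates, `g n` for the stochastic gradient at `x n`, `G n = ∇F (x n)`, and `u n`
for the normalized momentum, so that `x (n+1) = x n - (1 - β) α u n`. Summing the descent inequality
for a function with Lipschitz gradient (`le_add_inner_gradient_add_sq`) bounds
`(1 - β) α ∑ ⟪G n, u n⟫` by `F x₀ - F_*` plus a multiple of `∑ ‖u n‖²`. Expanding the momentum,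
`⟪G n, u n⟫` is a sum over `i ≤ n` and over coordinates of `β^(n-i) G_n g_i / √(ε + v_{n+1})`. In each
such term two things are changed (`le_mul_div_sqrt_sqAcc`):

* `G_n` becomes `G_i`. By Young's inequality this costs a multiple of the squared normalized gradient
  `g_i² / (ε + v_{i+1})` and of `(G_n - G_i)²`; the latter is a squared displacement, hence controlled
  by the steps `‖u l‖²` with `i ≤ l < n` (`sum_norm_sub_sq_le`).
* In the denominator the squared gradients from the `i`-th on, which are correlated with `g_i`, are
  replaced by their deterministic bound `(R - √ε)²`. This only increases the denominator, to at most
  `R √N`, and costs a quarter of `G_i²` over it and again a multiple of `g_i² / (ε + v_{i+1})`.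

The squared normalized gradients sum to at most `log (1 + N R² / ε)` per coordinate
(`sum_sq_div_le_log`), and they control `∑ ‖u n‖²` as well (`sum_momAcc_sq_div_le`). What remains
(`pathwise_bound`) is the weighted sum `∑ (1 - β^(N-j)) ‖G j‖²` together with noise terms
`G_i (g_i - G_i) / √(...)` whose denominators depend only on samples before the `i`-th one. As the
`i`-th sample is independent of the state reached before it, the noise has mean zero
(`integral_gradientNoise_eq_zero`). The weights `1 - β^(N-j)` are those of the law of the random
index, and their sum is at least `N - β / (1 - β)`.
-/

/-! ### Finite arithmetico-geometric sums -/

lemma sum_geometric_le {β : ℝ} (hβ : 0 ≤ β) (hβ' : β < 1) (K : ℕ) :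
    ∑ k ∈ Finset.range K, β ^ k ≤ 1 / (1 - β) := by
  have h1 : 0 < 1 - β := by linarith
  rw [le_div_iff₀ h1, geom_sum_mul_neg]
  have := pow_nonneg hβ K
  linarith

lemma sum_succ_mul_geometric_le {β : ℝ} (hβ : 0 ≤ β) (hβ' : β < 1) (K : ℕ) :
    ∑ k ∈ Finset.range K, ((k : ℝ) + 1) * β ^ k ≤ 1 / (1 - β) ^ 2 := by
  have h1 : 0 < 1 - β := by linarith
  have key : (∑ k ∈ Finset.range K, ((k : ℝ) + 1) * β ^ k) * (1 - β) ^ 2 +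
      β ^ K * (K * (1 - β) + 1) = 1 := by
    induction K with
    | zero => simp
    | succ K ih =>
      rw [Finset.sum_range_succ]
      push_cast
      linear_combination ih
  rw [le_div_iff₀ (by positivity)]
  have : 0 ≤ β ^ K * (K * (1 - β) + 1) := by positivity
  linarith

lemma sum_sq_mul_geometric_le {β : ℝ} (hβ : 0 ≤ β) (hβ' : β < 1) (K : ℕ) :
    ∑ k ∈ Finset.range K, (k : ℝ) ^ 2 * β ^ k ≤ 2 * β / (1 - β) ^ 3 := by
  have h1 : 0 < 1 - β := by linarith
  have key : (∑ k ∈ Finset.range K, (k : ℝ) * (k + 1) * β ^ k) * (1 - β) ^ 3 +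
      β ^ K * (K * (K + 1) * (1 - β) ^ 2 + 2 * (K + 1) * β * (1 - β) + 2 * β ^ 2) = 2 * β := by
    induction K with
    | zero => simp; ring
    | succ K ih =>
      rw [Finset.sum_range_succ]
      push_cast
      linear_combination ih
  have hle : ∑ k ∈ Finset.range K, (k : ℝ) ^ 2 * β ^ k ≤
      ∑ k ∈ Finset.range K, (k : ℝ) * (k + 1) * β ^ k := by
    refine Finset.sum_le_sum fun k _ => ?_
    have : 0 ≤ (k : ℝ) := k.cast_nonneg
    exact mul_le_mul_of_nonneg_right (by nlinarith) (pow_nonneg hβ k)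
  refine hle.trans ?_
  rw [le_div_iff₀ (by positivity)]
  have : 0 ≤ β ^ K * (K * (K + 1) * (1 - β) ^ 2 + 2 * (K + 1) * β * (1 - β) + 2 * β ^ 2) := by
    positivity
  linarith

/-! ### Double sums over pairs of iterations -/

/-- Convolution against a weight `w` with partial sums at most `W` multiplies a sum of nonnegative
terms by at most `W`. -/
lemma sum_convolution_le (w b : ℕ → ℝ) (W : ℝ) (N : ℕ) (hb : ∀ i, 0 ≤ b i)
    (hw : ∀ K, ∑ k ∈ Finset.range K, w k ≤ W) :
    ∑ n ∈ Finset.range N, ∑ i ∈ Finset.range (n + 1), w (n - i) * b i ≤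
      W * ∑ i ∈ Finset.range N, b i := by
  rw [Finset.sum_range_diag_flip N fun i k => w k * b i, Finset.mul_sum]
  refine Finset.sum_le_sum fun i _ => ?_
  rw [← Finset.sum_mul]
  exact mul_le_mul_of_nonneg_right (hw _) (hb i)

/-- Each lag `k = n - i` contributes, for each of its `k` offsets, a shifted copy of the sequence
`b`, whose sum is at most the full sum. -/
lemma sum_lag_window_le (c b : ℕ → ℝ) (N : ℕ) (hc : ∀ k, 0 ≤ c k) (hb : ∀ i, 0 ≤ b i) :
    ∑ n ∈ Finset.range N, ∑ i ∈ Finset.range (n + 1),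
        c (n - i) * ∑ q ∈ Finset.range (n - i), b (i + q) ≤
      (∑ k ∈ Finset.range N, c k * k) * ∑ i ∈ Finset.range N, b i := by
  rw [Finset.sum_range_diag_flip N fun i k => c k * ∑ q ∈ Finset.range k, b (i + q)]
  have hswap : ∑ m ∈ Finset.range N, ∑ k ∈ Finset.range (N - m),
        c k * ∑ q ∈ Finset.range k, b (m + q) =
      ∑ k ∈ Finset.range N, ∑ m ∈ Finset.range (N - k),
        c k * ∑ q ∈ Finset.range k, b (m + q) := by
    refine Finset.sum_comm' fun m k => ?_
    simp only [Finset.mem_range]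
    omega
  rw [hswap, Finset.sum_mul]
  refine Finset.sum_le_sum fun k hk => ?_
  rw [← Finset.mul_sum, mul_assoc]
  refine mul_le_mul_of_nonneg_left ?_ (hc k)
  rw [Finset.sum_comm, ← nsmul_eq_mul]
  refine (Finset.sum_le_card_nsmul _ _ (∑ i ∈ Finset.range N, b i) fun q hq => ?_).trans_eq
    (by simp)
  rw [Finset.mem_range] at hq hk
  calc ∑ m ∈ Finset.range (N - k), b (m + q)
      = ∑ m ∈ Finset.Ico q (N - k + q), b m := by
        rw [Finset.sum_Ico_eq_sum_range]
        simp [add_comm]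
    _ ≤ ∑ m ∈ Finset.range N, b m := by
        refine Finset.sum_le_sum_of_subset_of_nonneg (fun m hm => ?_) fun m _ _ => hb m
        simp only [Finset.mem_Ico, Finset.mem_range] at hm ⊢
        omega

/-! ### One coordinate of the accumulators -/

/-- Accumulated squares `∑_{l < n} g_l²` of one gradient coordinate. -/
noncomputable def sqAcc (g : ℕ → ℝ) (n : ℕ) : ℝ := ∑ l ∈ Finset.range n, g l ^ 2

/-- Heavy-ball accumulator `∑_{i ≤ n} β^(n-i) g_i` of one gradient coordinate; the sample of index
`n` is included. -/
noncomputable def momAcc (β : ℝ) (g : ℕ → ℝ) (n : ℕ) : ℝ :=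
  ∑ i ∈ Finset.range (n + 1), β ^ (n - i) * g i

lemma sqAcc_nonneg (g : ℕ → ℝ) (n : ℕ) : 0 ≤ sqAcc g n :=
  Finset.sum_nonneg fun _ _ => sq_nonneg _

lemma sqAcc_succ (g : ℕ → ℝ) (n : ℕ) : sqAcc g (n + 1) = sqAcc g n + g n ^ 2 :=
  Finset.sum_range_succ _ _

lemma sqAcc_mono (g : ℕ → ℝ) : Monotone (sqAcc g) :=
  monotone_nat_of_le_succ fun n => by
    rw [sqAcc_succ]
    linarith [sq_nonneg (g n)]

lemma sqAcc_add_le {g : ℕ → ℝ} {B : ℝ} {N : ℕ} (hg : ∀ n < N, |g n| ≤ B) (i k : ℕ)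
    (h : i + k ≤ N) : sqAcc g (i + k) ≤ sqAcc g i + k * B ^ 2 := by
  induction k with
  | zero => simp
  | succ k ih =>
    rw [← add_assoc, sqAcc_succ]
    have h1 := ih (by omega)
    have h2 : g (i + k) ^ 2 ≤ B ^ 2 := sq_le_sq' (abs_le.1 (hg (i + k) (by omega))).1
      (abs_le.1 (hg (i + k) (by omega))).2
    push_cast
    linarith

lemma momAcc_succ (β : ℝ) (g : ℕ → ℝ) (n : ℕ) :
    momAcc β g (n + 1) = β * momAcc β g n + g (n + 1) := by
  unfold momAcc
  rw [Finset.sum_range_succ _ (n + 1), Finset.mul_sum]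
  congr 1
  · refine Finset.sum_congr rfl fun i hi => ?_
    rw [Finset.mem_range] at hi
    rw [show n + 1 - i = (n - i) + 1 by omega, pow_succ]
    ring
  · simp

/-- The normalized squared increments of a sum telescope under the logarithm, because
`b / (A + b) ≤ log ((A + b) / A)`. -/
lemma sum_sq_div_le_log (g : ℕ → ℝ) {ε : ℝ} (hε : 0 < ε) (N : ℕ) :
    ∑ i ∈ Finset.range N, g i ^ 2 / (ε + sqAcc g (i + 1)) ≤ Real.log (1 + sqAcc g N / ε) := by
  have key : ∑ i ∈ Finset.range N, g i ^ 2 / (ε + sqAcc g (i + 1)) ≤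
      Real.log (ε + sqAcc g N) - Real.log ε := by
    induction N with
    | zero => simp [sqAcc]
    | succ N ih =>
      rw [Finset.sum_range_succ]
      have hA : 0 < ε + sqAcc g N := by linarith [sqAcc_nonneg g N]
      have hA' : 0 < ε + sqAcc g (N + 1) := by linarith [sqAcc_nonneg g (N + 1)]
      have h := Real.log_le_sub_one_of_pos (div_pos hA hA')
      rw [Real.log_div hA.ne' hA'.ne'] at h
      have h2 : g N ^ 2 / (ε + sqAcc g (N + 1)) =
          1 - (ε + sqAcc g N) / (ε + sqAcc g (N + 1)) := by
        rw [eq_sub_iff_add_eq, ← add_div, div_eq_one_iff_eq hA'.ne', sqAcc_succ]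
        ring
      linarith
  refine key.trans_eq ?_
  have hA : 0 < ε + sqAcc g N := by linarith [sqAcc_nonneg g N]
  rw [← Real.log_div hA.ne' hε.ne', add_div, div_self hε.ne']

lemma sum_sq_div_le_log_bound {g : ℕ → ℝ} {ε R : ℝ} {N : ℕ} (hε : 0 < ε)
    (hg : ∀ n < N, |g n| ≤ R - Real.sqrt ε) :
    ∑ i ∈ Finset.range N, g i ^ 2 / (ε + sqAcc g (i + 1)) ≤ Real.log (1 + N * R ^ 2 / ε) := by
  refine (sum_sq_div_le_log g hε N).trans (Real.log_le_log ?_ ?_)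
  · have := div_nonneg (sqAcc_nonneg g N) hε.le
    linarith
  · have h1 : sqAcc g N ≤ N * R ^ 2 := by
      have h2 := sqAcc_add_le (B := R) (fun n hn => (hg n hn).trans
        (by linarith [Real.sqrt_nonneg ε])) 0 N (by omega)
      simpa [sqAcc] using h2
    linarith [div_le_div_of_nonneg_right h1 hε.le]

/-- The squared normalized momentum is controlled by the squared normalized gradients, by
Cauchy-Schwarz for the weights `β^(n-i)` and the monotonicity of the denominators. -/
lemma sum_momAcc_sq_div_le (g : ℕ → ℝ) {ε β : ℝ} (hε : 0 < ε) (hβ : 0 ≤ β) (hβ' : β < 1) (N : ℕ) :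
    ∑ n ∈ Finset.range N, (momAcc β g n / Real.sqrt (ε + sqAcc g (n + 1))) ^ 2 ≤
      1 / (1 - β) ^ 2 * ∑ i ∈ Finset.range N, g i ^ 2 / (ε + sqAcc g (i + 1)) := by
  have h1 : 0 < 1 - β := by linarith
  have hpos : ∀ n, 0 < ε + sqAcc g n := fun n => by linarith [sqAcc_nonneg g n]
  have hstep : ∀ n, (momAcc β g n / Real.sqrt (ε + sqAcc g (n + 1))) ^ 2 ≤
      1 / (1 - β) * ∑ i ∈ Finset.range (n + 1), β ^ (n - i) *
        (g i ^ 2 / (ε + sqAcc g (i + 1))) := by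
    intro n
    rw [div_pow, Real.sq_sqrt (hpos _).le]
    have hcs : momAcc β g n ^ 2 ≤ (∑ i ∈ Finset.range (n + 1), β ^ (n - i)) *
        ∑ i ∈ Finset.range (n + 1), β ^ (n - i) * g i ^ 2 := by
      refine Finset.sum_sq_le_sum_mul_sum_of_sq_le_mul _ (fun i _ => pow_nonneg hβ _)
        (fun i _ => mul_nonneg (pow_nonneg hβ _) (sq_nonneg _)) fun i _ => ?_
      exact le_of_eq (by ring)
    have hgeo : ∑ i ∈ Finset.range (n + 1), β ^ (n - i) ≤ 1 / (1 - β) := by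
      have := Finset.sum_range_reflect (fun k => β ^ k) (n + 1)
      simp only [Nat.add_sub_cancel] at this
      rw [this]
      exact sum_geometric_le hβ hβ' _
    have hnn : 0 ≤ ∑ i ∈ Finset.range (n + 1), β ^ (n - i) * g i ^ 2 :=
      Finset.sum_nonneg fun i _ => mul_nonneg (pow_nonneg hβ _) (sq_nonneg _)
    calc momAcc β g n ^ 2 / (ε + sqAcc g (n + 1))
        ≤ (1 / (1 - β) * ∑ i ∈ Finset.range (n + 1), β ^ (n - i) * g i ^ 2) /
            (ε + sqAcc g (n + 1)) :=
          div_le_div_of_nonneg_right (hcs.trans (mul_le_mul_of_nonneg_right hgeo hnn))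
            (hpos _).le
      _ = 1 / (1 - β) * ∑ i ∈ Finset.range (n + 1), β ^ (n - i) *
            (g i ^ 2 / (ε + sqAcc g (n + 1))) := by
          rw [mul_div_assoc, Finset.sum_div]
          simp_rw [mul_div_assoc]
      _ ≤ _ := by
          refine mul_le_mul_of_nonneg_left (Finset.sum_le_sum fun i hi => ?_) (by positivity)
          refine mul_le_mul_of_nonneg_left ?_ (pow_nonneg hβ _)
          refine div_le_div_of_nonneg_left (sq_nonneg _) (hpos _) ?_
          have := sqAcc_mono g (show i + 1 ≤ n + 1 by rw [Finset.mem_range] at hi; omega)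
          linarith
  calc _ ≤ ∑ n ∈ Finset.range N, 1 / (1 - β) * ∑ i ∈ Finset.range (n + 1), β ^ (n - i) *
        (g i ^ 2 / (ε + sqAcc g (i + 1))) := Finset.sum_le_sum fun n _ => hstep n
    _ ≤ 1 / (1 - β) * (1 / (1 - β) * ∑ i ∈ Finset.range N, g i ^ 2 / (ε + sqAcc g (i + 1))) := by
        rw [← Finset.mul_sum]
        refine mul_le_mul_of_nonneg_left ?_ (by positivity)
        exact sum_convolution_le (fun k => β ^ k) _ _ N
          (fun i => div_nonneg (sq_nonneg _) (hpos _).le) (sum_geometric_le hβ hβ')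
    _ = _ := by
        rw [← mul_assoc]
        congr 1
        field_simp

/-! ### Decorrelating a gradient from its own normalization -/

/-- Replacing the denominator `p` by a larger `q` with `q² ≤ p² + r²`, `r ≤ q` costs a quarter of
`G² / q` and `r` times the squared normalized gradient. -/
lemma mul_div_change_denominator {G g p q r : ℝ} (hp : 0 < p) (hpq : p ≤ q) (hr : 0 ≤ r)
    (hrq : r ≤ q) (hqp : q ^ 2 ≤ p ^ 2 + r ^ 2) :
    G * g / q - G ^ 2 / (4 * q) - r * (g ^ 2 / p ^ 2) ≤ G * g / p := by
  have hq : 0 < q := hp.trans_le hpq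
  have hdiff : |G * g| * (1 / p - 1 / q) ≤ |G * g| * (r ^ 2 / (p * q ^ 2)) := by
    refine mul_le_mul_of_nonneg_left ?_ (abs_nonneg _)
    rw [div_sub_div _ _ hp.ne' hq.ne', div_le_div_iff₀ (by positivity) (by positivity)]
    have h1 : (q - p) * q ≤ r ^ 2 := by nlinarith
    have : 0 < p * q := by positivity
    calc (1 * q - p * 1) * (p * q ^ 2) = ((q - p) * q) * (p * q) := by ring
      _ ≤ r ^ 2 * (p * q) := mul_le_mul_of_nonneg_right h1 this.le
  have hyoung : |G * g| * (r ^ 2 / (p * q ^ 2)) ≤ G ^ 2 / (4 * q) + r * (g ^ 2 / p ^ 2) := by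
    have h1 : |G * g| * (r ^ 2 / (p * q ^ 2)) ≤
        G ^ 2 / (4 * q) + r ^ 4 / q ^ 3 * (g ^ 2 / p ^ 2) := by
      have hsq : 0 ≤ (|G| / 2 - r ^ 2 * |g| / (p * q)) ^ 2 / q := by positivity
      have hid : (|G| / 2 - r ^ 2 * |g| / (p * q)) ^ 2 / q =
          |G| ^ 2 / (4 * q) + r ^ 4 / q ^ 3 * (|g| ^ 2 / p ^ 2) -
            |G| * |g| * (r ^ 2 / (p * q ^ 2)) := by
        field_simp
        ring
      rw [hid, sq_abs, sq_abs, ← abs_mul] at hsq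
      linarith
    have h2 : r ^ 4 / q ^ 3 ≤ r := by
      rw [div_le_iff₀ (by positivity)]
      have : r ^ 3 ≤ q ^ 3 := pow_le_pow_left₀ hr hrq 3
      nlinarith
    have h3 : 0 ≤ g ^ 2 / p ^ 2 := by positivity
    nlinarith
  have hsign : -(|G * g| * (1 / p - 1 / q)) ≤ G * g * (1 / p - 1 / q) := by
    rw [← neg_mul]
    refine mul_le_mul_of_nonneg_right (neg_abs_le _) ?_
    rw [sub_nonneg]
    exact one_div_le_one_div_of_le hp hpq
  have : G * g * (1 / p - 1 / q) = G * g / p - G * g / q := by ring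
  linarith

/-- Lower bound for the contribution of the gradient coordinate `g_i` to the inner product of
`∇F(x_n)` with the step made from `x_n`. The denominator `√(ε + v_{n+1})` is replaced by one that
only involves the samples before the `i`-th one, the later ones being replaced by their bound, so
that the first term on the left has zero mean. -/
lemma le_mul_div_sqrt_sqAcc {g : ℕ → ℝ} {ε R β : ℝ} {N : ℕ} (hε : 0 < ε)
    (hR : Real.sqrt ε ≤ R) (hβ' : β < 1) (hg : ∀ n < N, |g n| ≤ R - Real.sqrt ε)
    {n i : ℕ} (hn : n < N) (hi : i ≤ n) (G G' : ℝ) :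
    G * (g i - G) / Real.sqrt (ε + (sqAcc g i + ((n - i : ℕ) + 1) * (R - Real.sqrt ε) ^ 2)) +
        G ^ 2 / (2 * R * Real.sqrt N) -
        (R * (((n - i : ℕ) + 1) + 1 / (1 - β)) * (g i ^ 2 / (ε + sqAcc g (i + 1))) +
          (1 - β) / (4 * R) * (G' - G) ^ 2) ≤
      G' * g i / Real.sqrt (ε + sqAcc g (n + 1)) := by
  obtain ⟨k, rfl⟩ := Nat.exists_eq_add_of_le hi
  have hs : 0 < Real.sqrt ε := Real.sqrt_pos.2 hε
  have hss : Real.sqrt ε ^ 2 = ε := Real.sq_sqrt hε.le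
  have hR0 : 0 < R := hs.trans_le hR
  have h1 : 0 < 1 - β := by linarith
  have hB : 0 ≤ R - Real.sqrt ε := by linarith
  have hk : (0 : ℝ) ≤ k := k.cast_nonneg
  rw [Nat.add_sub_cancel_left]
  set s := Real.sqrt ε with hsdef
  set B := R - s with hBdef
  have hv := sqAcc_nonneg g i
  have hV := sqAcc_nonneg g (i + k + 1)
  have hup : sqAcc g (i + k + 1) ≤ sqAcc g i + (k + 1) * B ^ 2 := by
    have := sqAcc_add_le hg i (k + 1) (by omega)
    push_cast at this
    exact this
  set p := Real.sqrt (ε + sqAcc g (i + k + 1)) with hpdef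
  set q := Real.sqrt (ε + (sqAcc g i + (k + 1) * B ^ 2)) with hqdef
  have hkB : 0 ≤ (k + 1) * B ^ 2 := by positivity
  have hp2 : p ^ 2 = ε + sqAcc g (i + k + 1) := Real.sq_sqrt (by linarith)
  have hq2 : q ^ 2 = ε + (sqAcc g i + (k + 1) * B ^ 2) := Real.sq_sqrt (by linarith)
  have hp : 0 < p := Real.sqrt_pos.2 (by linarith)
  have hpq : p ≤ q := Real.sqrt_le_sqrt (by linarith)
  have hq : 0 < q := hp.trans_le hpq
  have hr2 : Real.sqrt ((k + 1) * B ^ 2) ^ 2 = (k + 1) * B ^ 2 := Real.sq_sqrt hkB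
  have hrR : Real.sqrt ((k + 1) * B ^ 2) ≤ R * (k + 1) := by
    rw [Real.sqrt_le_left (by positivity)]
    have : B ^ 2 ≤ R ^ 2 := pow_le_pow_left₀ hB (by linarith) 2
    nlinarith [mul_nonneg hk (sq_nonneg R), mul_nonneg (mul_nonneg hk hk) (sq_nonneg R)]
  have hvi : sqAcc g i ≤ sqAcc g (i + k + 1) := sqAcc_mono g (by omega)
  have hmain := mul_div_change_denominator (G := G) (g := g i) hp hpq (Real.sqrt_nonneg _)
    (Real.sqrt_le_sqrt (by linarith)) (r := Real.sqrt ((k + 1) * B ^ 2)) (by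
      rw [hr2, hp2, hq2]; linarith)
  have hU : g i ^ 2 / p ^ 2 ≤ g i ^ 2 / (ε + sqAcc g (i + 1)) := by
    rw [hp2]
    refine div_le_div_of_nonneg_left (sq_nonneg _) (by linarith [sqAcc_nonneg g (i + 1)]) ?_
    linarith [sqAcc_mono g (show i + 1 ≤ i + k + 1 by omega)]
  have hqN : q ≤ R * Real.sqrt N := by
    have hiB : sqAcc g i ≤ i * B ^ 2 := by
      have := sqAcc_add_le hg 0 i (by omega)
      simpa [sqAcc] using this
    have hN : (i : ℝ) + k + 1 ≤ N := by exact_mod_cast hn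
    rw [hqdef, Real.sqrt_le_left (by positivity), mul_pow, Real.sq_sqrt (Nat.cast_nonneg _)]
    have hsB : ε + B ^ 2 ≤ R ^ 2 := by
      have hRB : R = s + B := by rw [hBdef]; ring
      have hsB0 : 0 ≤ s * B := mul_nonneg hs.le hB
      rw [hRB, ← hss]
      linarith [show (s + B) ^ 2 = s ^ 2 + B ^ 2 + 2 * (s * B) by ring]
    have hBR : B ^ 2 ≤ R ^ 2 := by linarith
    have : (i + k : ℝ) * B ^ 2 ≤ (i + k) * R ^ 2 :=
      mul_le_mul_of_nonneg_left hBR (by positivity)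
    have h4 : R ^ 2 * ((i : ℝ) + k + 1) ≤ R ^ 2 * N :=
      mul_le_mul_of_nonneg_left hN (sq_nonneg R)
    linarith [show R ^ 2 * ((i : ℝ) + k + 1) = (i + k) * R ^ 2 + R ^ 2 by ring,
      show (i : ℝ) * B ^ 2 + (k + 1) * B ^ 2 = (i + k) * B ^ 2 + B ^ 2 by ring]
  -- three quarters of `G² / q` are left, more than the half that is needed
  have hG : G ^ 2 / (2 * R * Real.sqrt N) ≤ 3 * (G ^ 2 / (4 * q)) := by
    have h5 : G ^ 2 / (2 * R * Real.sqrt N) ≤ G ^ 2 / (2 * q) :=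
      div_le_div_of_nonneg_left (sq_nonneg _) (by positivity) (by linarith)
    have h6 : G ^ 2 / (2 * q) = 2 * (G ^ 2 / (4 * q)) := by field_simp; norm_num
    have h7 : 0 ≤ G ^ 2 / (4 * q) := by positivity
    linarith
  have hZ : G * (g i - G) / q = G * g i / q - 4 * (G ^ 2 / (4 * q)) := by
    field_simp
  -- Young's inequality, weighted so that after summation over the lags the drift and the squared
  -- normalized gradients both contribute at the same order `1 / (1 - β)` to the constant
  have hcross : -((1 - β) / (4 * R) * (G' - G) ^ 2 + R * (1 / (1 - β)) * (g i ^ 2 / p ^ 2)) ≤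
      (G' - G) * g i / p := by
    have hsq : 0 ≤ ((1 - β) * (G' - G) / 2 + R * (g i / p)) ^ 2 / (R * (1 - β)) := by positivity
    have hid : ((1 - β) * (G' - G) / 2 + R * (g i / p)) ^ 2 / (R * (1 - β)) =
        (1 - β) / (4 * R) * (G' - G) ^ 2 + R * (1 / (1 - β)) * (g i ^ 2 / p ^ 2) +
          (G' - G) * g i / p := by
      field_simp
      ring
    linarith
  have hsplit : G' * g i / p = G * g i / p + (G' - G) * g i / p := by ring
  have hr' : Real.sqrt ((k + 1) * B ^ 2) * (g i ^ 2 / p ^ 2) ≤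
      R * (k + 1) * (g i ^ 2 / (ε + sqAcc g (i + 1))) :=
    mul_le_mul hrR hU (by positivity) (by positivity)
  have hb' : R * (1 / (1 - β)) * (g i ^ 2 / p ^ 2) ≤
      R * (1 / (1 - β)) * (g i ^ 2 / (ε + sqAcc g (i + 1))) :=
    mul_le_mul_of_nonneg_left hU (by positivity)
  have hdist : R * ((k + 1) + 1 / (1 - β)) * (g i ^ 2 / (ε + sqAcc g (i + 1))) =
      R * (k + 1) * (g i ^ 2 / (ε + sqAcc g (i + 1))) +
        R * (1 / (1 - β)) * (g i ^ 2 / (ε + sqAcc g (i + 1))) := by ring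
  rw [hsplit, hdist, hZ]
  linarith

/-! ### Descent for functions with Lipschitz gradient -/

lemma le_add_inner_gradient_add_sq {E : Type*} [NormedAddCommGroup E] [InnerProductSpace ℝ E]
    [CompleteSpace E] {F : E → ℝ} {L : ℝ} (hF : Differentiable ℝ F)
    (hL : ∀ x y, ‖gradient F x - gradient F y‖ ≤ L * ‖x - y‖) (x h : E) :
    F (x + h) ≤ F x + inner ℝ (gradient F x) h + L / 2 * ‖h‖ ^ 2 := by
  let ψ : ℝ → ℝ := fun t =>
    F x + t * inner ℝ (gradient F x) h + L / 2 * t ^ 2 * ‖h‖ ^ 2 - F (x + t • h)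
  have hψ : ∀ t, HasDerivAt ψ (inner ℝ (gradient F x) h + L * t * ‖h‖ ^ 2 -
      inner ℝ (gradient F (x + t • h)) h) t := by
    intro t
    have h1 : HasDerivAt (fun t : ℝ => x + t • h) h t := by
      simpa using ((hasDerivAt_id t).smul_const h).const_add x
    have h2 := ((hF (x + t • h)).hasGradientAt.hasFDerivAt).comp_hasDerivAt t h1
    have h3 : HasDerivAt (fun t : ℝ => F x + t * inner ℝ (gradient F x) h +
        L / 2 * t ^ 2 * ‖h‖ ^ 2) (inner ℝ (gradient F x) h + L * t * ‖h‖ ^ 2) t := by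
      have h4 := ((hasDerivAt_id t).mul_const (inner ℝ (gradient F x) h)).const_add (F x)
      have h5 := ((hasDerivAt_pow 2 t).const_mul (L / 2)).mul_const (‖h‖ ^ 2)
      refine (h4.add h5).congr_deriv ?_
      push_cast
      ring
    exact (h3.sub h2).congr_deriv (by rw [InnerProductSpace.toDual_apply_apply])
  have hmono : MonotoneOn ψ (Set.Ici 0) := by
    refine monotoneOn_of_deriv_nonneg (convex_Ici 0)
      (fun t _ => (hψ t).continuousAt.continuousWithinAt)
      (fun t _ => (hψ t).differentiableAt.differentiableWithinAt) fun t ht => ?_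
    rw [interior_Ici, Set.mem_Ioi] at ht
    rw [(hψ t).deriv]
    have h1 : inner ℝ (gradient F (x + t • h) - gradient F x) h ≤ L * t * ‖h‖ ^ 2 := by
      refine (real_inner_le_norm _ _).trans ?_
      have h2 := hL (x + t • h) x
      rw [add_sub_cancel_left, norm_smul, Real.norm_of_nonneg ht.le] at h2
      nlinarith [mul_le_mul_of_nonneg_right h2 (norm_nonneg h)]
    rw [inner_sub_left] at h1
    linarith
  have := hmono (Set.mem_Ici.2 le_rfl) (Set.mem_Ici.2 zero_le_one) zero_le_one
  simp only [ψ, zero_smul, one_smul, zero_mul, one_mul, one_pow, mul_one, add_zero,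
    ne_eq, OfNat.ofNat_ne_zero, not_false_eq_true, zero_pow, mul_zero, sub_self] at this
  linarith

/-! ### The pathwise inequality -/

lemma norm_sum_range_sq_le {E : Type*} [SeminormedAddCommGroup E] (u : ℕ → E) (i k : ℕ) :
    ‖∑ q ∈ Finset.range k, u (i + q)‖ ^ 2 ≤ k * ∑ q ∈ Finset.range k, ‖u (i + q)‖ ^ 2 := by
  have h1 := pow_le_pow_left₀ (norm_nonneg _) (norm_sum_le (Finset.range k) fun q => u (i + q)) 2
  have h2 := sq_sum_le_card_mul_sum_sq (s := Finset.range k) (f := fun q => ‖u (i + q)‖)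
  rw [Finset.card_range] at h2
  exact h1.trans h2

/-- Discounted drift of a Lipschitz vector field `G` along a sequence with increments `-a • u n`. -/
lemma sum_norm_sub_sq_le {E : Type*} [NormedAddCommGroup E] [NormedSpace ℝ E] {G : E → E}
    {x u : ℕ → E} {L a β : ℝ} (hβ : 0 ≤ β) (hβ' : β < 1)
    (hG : ∀ y z, ‖G y - G z‖ ≤ L * ‖y - z‖) (hx : ∀ n, x (n + 1) = x n - a • u n) (N : ℕ) :
    ∑ n ∈ Finset.range N, ∑ i ∈ Finset.range (n + 1), β ^ (n - i) * ‖G (x n) - G (x i)‖ ^ 2 ≤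
      2 * β / (1 - β) ^ 3 * (L * a) ^ 2 * ∑ n ∈ Finset.range N, ‖u n‖ ^ 2 := by
  have hdisp : ∀ i k, x (i + k) - x i = -(a • ∑ q ∈ Finset.range k, u (i + q)) := by
    intro i k
    induction k with
    | zero => simp
    | succ k ih =>
      rw [← add_assoc, hx, Finset.sum_range_succ, smul_add, neg_add, ← ih]
      abel
  have hterm : ∀ n, ∀ i ∈ Finset.range (n + 1), β ^ (n - i) * ‖G (x n) - G (x i)‖ ^ 2 ≤
      (L * a) ^ 2 * ((β ^ (n - i) * ((n - i : ℕ) : ℝ)) *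
        ∑ q ∈ Finset.range (n - i), ‖u (i + q)‖ ^ 2) := by
    intro n i hi
    obtain ⟨k, rfl⟩ := Nat.exists_eq_add_of_le (Nat.lt_succ_iff.1 (Finset.mem_range.1 hi))
    rw [Nat.add_sub_cancel_left]
    have h1 : ‖G (x (i + k)) - G (x i)‖ ^ 2 ≤
        (L * a) ^ 2 * (k * ∑ q ∈ Finset.range k, ‖u (i + q)‖ ^ 2) := by
      have h2 := pow_le_pow_left₀ (norm_nonneg _) (hG (x (i + k)) (x i)) 2
      rw [hdisp, norm_neg, norm_smul, mul_pow, mul_pow, Real.norm_eq_abs, sq_abs, ← mul_assoc,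
        ← mul_pow] at h2
      exact h2.trans (mul_le_mul_of_nonneg_left (norm_sum_range_sq_le u i k) (sq_nonneg _))
    refine (mul_le_mul_of_nonneg_left h1 (pow_nonneg hβ k)).trans_eq ?_
    ring
  calc _ ≤ ∑ n ∈ Finset.range N, ∑ i ∈ Finset.range (n + 1),
        (L * a) ^ 2 * ((β ^ (n - i) * ((n - i : ℕ) : ℝ)) *
          ∑ q ∈ Finset.range (n - i), ‖u (i + q)‖ ^ 2) :=
        Finset.sum_le_sum fun n _ => Finset.sum_le_sum (hterm n)
    _ ≤ (L * a) ^ 2 * ((∑ k ∈ Finset.range N, (β ^ k * k) * k) *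
          ∑ n ∈ Finset.range N, ‖u n‖ ^ 2) := by
        simp_rw [← Finset.mul_sum]
        exact mul_le_mul_of_nonneg_left (sum_lag_window_le (fun k => β ^ k * k)
          (fun i => ‖u i‖ ^ 2) N (fun k => by positivity) fun i => sq_nonneg _) (sq_nonneg _)
    _ ≤ (L * a) ^ 2 * (2 * β / (1 - β) ^ 3 * ∑ n ∈ Finset.range N, ‖u n‖ ^ 2) := by
        refine mul_le_mul_of_nonneg_left (mul_le_mul_of_nonneg_right ?_
          (Finset.sum_nonneg fun _ _ => sq_nonneg _)) (sq_nonneg _)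
        refine le_trans (le_of_eq ?_) (sum_sq_mul_geometric_le hβ hβ' N)
        exact Finset.sum_congr rfl fun k _ => by ring
    _ = _ := by ring

/-- Normalized gradient noise of one coordinate: `G` is the true and `g` the stochastic gradient
coordinate along the iterates. The denominator dominates `√(ε + v_{n+1})` but depends only on the
samples before the `i`-th one. -/
noncomputable def gradientNoise (ε R : ℝ) (G g : ℕ → ℝ) (n i : ℕ) : ℝ :=
  G i * (g i - G i) / Real.sqrt (ε + (sqAcc g i + ((n - i : ℕ) + 1) * (R - Real.sqrt ε) ^ 2))

/-- Summed form of `le_mul_div_sqrt_sqAcc` for one coordinate. -/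
lemma sum_alignment_le {g : ℕ → ℝ} {ε R β : ℝ} {N : ℕ} (hε : 0 < ε)
    (hR : Real.sqrt ε ≤ R) (hβ : 0 ≤ β) (hβ' : β < 1) (hg : ∀ n < N, |g n| ≤ R - Real.sqrt ε)
    (G : ℕ → ℝ) :
    ∑ n ∈ Finset.range N, ∑ i ∈ Finset.range (n + 1), β ^ (n - i) * gradientNoise ε R G g n i +
        1 / (2 * R * Real.sqrt N) *
          ∑ n ∈ Finset.range N, ∑ i ∈ Finset.range (n + 1), β ^ (n - i) * G i ^ 2 -
        (2 * R / (1 - β) ^ 2 * Real.log (1 + N * R ^ 2 / ε) + (1 - β) / (4 * R) *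
          ∑ n ∈ Finset.range N, ∑ i ∈ Finset.range (n + 1), β ^ (n - i) * (G n - G i) ^ 2) ≤
      ∑ n ∈ Finset.range N, G n * (momAcc β g n / Real.sqrt (ε + sqAcc g (n + 1))) := by
  have hs : 0 < Real.sqrt ε := Real.sqrt_pos.2 hε
  have hR0 : 0 < R := hs.trans_le hR
  have h1 : 0 < 1 - β := by linarith
  have hpos : ∀ n, 0 < ε + sqAcc g n := fun n => by linarith [sqAcc_nonneg g n]
  have hlog := sum_sq_div_le_log_bound hε hg
  set U : ℕ → ℝ := fun i => g i ^ 2 / (ε + sqAcc g (i + 1)) with hU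
  have hU0 : ∀ i, 0 ≤ U i := fun i => div_nonneg (sq_nonneg _) (hpos _).le
  have hterm : ∀ n ∈ Finset.range N, ∑ i ∈ Finset.range (n + 1),
      (β ^ (n - i) * gradientNoise ε R G g n i + 1 / (2 * R * Real.sqrt N) *
        (β ^ (n - i) * G i ^ 2) -
        ((R * ((((n - i : ℕ) : ℝ) + 1) * β ^ (n - i) + 1 / (1 - β) * β ^ (n - i))) * U i +
          (1 - β) / (4 * R) * (β ^ (n - i) * (G n - G i) ^ 2))) ≤
      G n * (momAcc β g n / Real.sqrt (ε + sqAcc g (n + 1))) := by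
    intro n hn
    rw [momAcc, Finset.sum_div, Finset.mul_sum]
    refine Finset.sum_le_sum fun i hi => ?_
    have h := mul_le_mul_of_nonneg_left (le_mul_div_sqrt_sqAcc hε hR hβ' hg
      (Finset.mem_range.1 hn) (Nat.lt_succ_iff.1 (Finset.mem_range.1 hi)) (G i) (G n))
      (pow_nonneg hβ (n - i))
    refine le_trans (le_of_eq ?_) (h.trans_eq ?_)
    · rw [gradientNoise, hU]
      ring
    · ring
  have hsum := Finset.sum_le_sum hterm
  simp only [Finset.sum_sub_distrib, Finset.sum_add_distrib, ← Finset.mul_sum] at hsum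
  have hw : ∀ K, ∑ k ∈ Finset.range K, R * (((k : ℝ) + 1) * β ^ k + 1 / (1 - β) * β ^ k) ≤
      2 * R / (1 - β) ^ 2 := by
    intro K
    rw [← Finset.mul_sum, Finset.sum_add_distrib, ← Finset.mul_sum]
    have h2 := sum_succ_mul_geometric_le hβ hβ' K
    have h3 := mul_le_mul_of_nonneg_left (sum_geometric_le hβ hβ' K)
      (show 0 ≤ 1 / (1 - β) by positivity)
    have h4 : 1 / (1 - β) * (1 / (1 - β)) = 1 / (1 - β) ^ 2 := by field_simp
    calc _ ≤ R * (1 / (1 - β) ^ 2 + 1 / (1 - β) ^ 2) :=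
          mul_le_mul_of_nonneg_left (by linarith) hR0.le
      _ = _ := by ring
  have hUsum := sum_convolution_le
    (fun k => R * (((k : ℝ) + 1) * β ^ k + 1 / (1 - β) * β ^ k)) U _ N hU0 hw
  have hUlog : 2 * R / (1 - β) ^ 2 * ∑ i ∈ Finset.range N, U i ≤
      2 * R / (1 - β) ^ 2 * Real.log (1 + N * R ^ 2 / ε) :=
    mul_le_mul_of_nonneg_left hlog (by positivity)
  linarith

/-- The discounted double sum weighs iterate `j` by a multiple of `1 - β^(N-j)`, which is where the
law of the random index comes from. -/
lemma sum_discounted_eq (b : ℕ → ℝ) {β : ℝ} (hβ' : β < 1) (N : ℕ) :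
    ∑ n ∈ Finset.range N, ∑ i ∈ Finset.range (n + 1), β ^ (n - i) * b i =
      1 / (1 - β) * ∑ j ∈ Finset.range N, (1 - β ^ (N - j)) * b j := by
  have h1 : 1 - β ≠ 0 := by linarith
  rw [Finset.sum_range_diag_flip N fun i k => β ^ k * b i, Finset.mul_sum]
  refine Finset.sum_congr rfl fun j _ => ?_
  rw [← Finset.sum_mul, ← geom_sum_mul_neg]
  field_simp

/-- The convergence bound before taking expectations: it holds along every trajectory whose
stochastic gradients respect the bound, up to a weighted sum of gradient noises. -/
theorem pathwise_bound {d : ℕ} {F : EuclideanSpace ℝ (Fin d) → ℝ} (hF : Differentiable ℝ F)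
    {Fstar R L ε α β : ℝ} (hε : 0 < ε) (hR : Real.sqrt ε ≤ R) (hL0 : 0 ≤ L)
    (h_below : ∀ x, Fstar ≤ F x)
    (hL : ∀ x y, ‖gradient F x - gradient F y‖ ≤ L * ‖x - y‖)
    (hα : 0 < α) (hβ : 0 ≤ β) (hβ' : β < 1) {N : ℕ}
    {x g u : ℕ → EuclideanSpace ℝ (Fin d)}
    (hg : ∀ n < N, ∀ c, |g n c| ≤ R - Real.sqrt ε)
    (hu : ∀ n c, u n c = momAcc β (fun l => g l c) n /
      Real.sqrt (ε + sqAcc (fun l => g l c) (n + 1)))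
    (hx : ∀ n, x (n + 1) = x n - ((1 - β) * α) • u n) :
    α / (2 * R * Real.sqrt N) *
        ∑ j ∈ Finset.range N, (1 - β ^ (N - j)) * ‖gradient F (x j)‖ ^ 2 +
      (1 - β) * α * ∑ c, ∑ n ∈ Finset.range N, ∑ i ∈ Finset.range (n + 1),
        β ^ (n - i) * gradientNoise ε R (fun l => gradient F (x l) c) (fun l => g l c) n i ≤
      F (x 0) - Fstar +
        α / (2 * R) * adagradConst d α R L β * Real.log (1 + N * R ^ 2 / ε) := by
  have hs : 0 < Real.sqrt ε := Real.sqrt_pos.2 hε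
  have hR0 : 0 < R := hs.trans_le hR
  have h1 : 0 < 1 - β := by linarith
  set Λ := Real.log (1 + N * R ^ 2 / ε) with hΛ
  have hΛ0 : 0 ≤ Λ := Real.log_nonneg (by
    have : 0 ≤ N * R ^ 2 / ε := by positivity
    linarith)
  set a := (1 - β) * α with ha
  have ha0 : 0 < a := mul_pos h1 hα
  -- total size of the normalized steps
  have hu2 : ∑ n ∈ Finset.range N, ‖u n‖ ^ 2 ≤ 1 / (1 - β) ^ 2 * (d * Λ) := by
    simp_rw [EuclideanSpace.real_norm_sq_eq]
    rw [Finset.sum_comm]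
    calc ∑ c, ∑ n ∈ Finset.range N, u n c ^ 2 ≤ ∑ c : Fin d, 1 / (1 - β) ^ 2 * Λ := by
          refine Finset.sum_le_sum fun c _ => ?_
          simp_rw [hu]
          refine (sum_momAcc_sq_div_le _ hε hβ hβ' N).trans ?_
          exact mul_le_mul_of_nonneg_left
            (sum_sq_div_le_log_bound hε fun n hn => hg n hn c) (by positivity)
      _ = _ := by
          rw [Finset.sum_const, Finset.card_univ, Fintype.card_fin, nsmul_eq_mul]
          ring
  -- telescoped descent
  have hdesc : ∀ K, F (x K) ≤ F (x 0) -
      a * ∑ n ∈ Finset.range K, inner ℝ (gradient F (x n)) (u n) +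
      L / 2 * a ^ 2 * ∑ n ∈ Finset.range K, ‖u n‖ ^ 2 := by
    intro K
    induction K with
    | zero => simp
    | succ K ih =>
      have h := le_add_inner_gradient_add_sq hF hL (x K) (-(a • u K))
      rw [← sub_eq_add_neg, ← hx, inner_neg_right, real_inner_smul_right, norm_neg, norm_smul,
        mul_pow, Real.norm_eq_abs, sq_abs] at h
      rw [Finset.sum_range_succ, Finset.sum_range_succ]
      linarith
  have hdrift := sum_norm_sub_sq_le hβ hβ' hL hx N
  have halign := Finset.sum_le_sum fun (c : Fin d) (_ : c ∈ Finset.univ) =>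
    sum_alignment_le hε hR hβ hβ' (fun n hn => hg n hn c) fun l => gradient F (x l) c
  have hinner : ∑ c, ∑ n ∈ Finset.range N, gradient F (x n) c * (momAcc β (fun l => g l c) n /
      Real.sqrt (ε + sqAcc (fun l => g l c) (n + 1))) =
      ∑ n ∈ Finset.range N, inner ℝ (gradient F (x n)) (u n) := by
    rw [Finset.sum_comm]
    refine Finset.sum_congr rfl fun n _ => ?_
    rw [PiLp.inner_apply]
    refine Finset.sum_congr rfl fun c _ => ?_
    rw [← hu, real_inner_eq_re_inner]
    simp [mul_comm]
  have hnorm : ∀ y : ℕ → ℕ → EuclideanSpace ℝ (Fin d),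
      ∑ c, ∑ n ∈ Finset.range N, ∑ i ∈ Finset.range (n + 1), β ^ (n - i) * y n i c ^ 2 =
      ∑ n ∈ Finset.range N, ∑ i ∈ Finset.range (n + 1), β ^ (n - i) * ‖y n i‖ ^ 2 := by
    intro y
    rw [Finset.sum_comm]
    refine Finset.sum_congr rfl fun n _ => ?_
    rw [Finset.sum_comm]
    refine Finset.sum_congr rfl fun i _ => ?_
    rw [EuclideanSpace.real_norm_sq_eq, Finset.mul_sum]
  have hG := hnorm fun _ i => gradient F (x i)
  have hGd := hnorm fun n i => gradient F (x n) - gradient F (x i)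
  simp only [PiLp.sub_apply] at hGd
  rw [hinner] at halign
  simp only [Finset.sum_sub_distrib, Finset.sum_add_distrib, ← Finset.mul_sum, Finset.sum_const,
    Finset.card_univ, Fintype.card_fin, nsmul_eq_mul] at halign
  rw [hG, hGd, sum_discounted_eq _ hβ'] at halign
  set Z := ∑ c, ∑ n ∈ Finset.range N, ∑ i ∈ Finset.range (n + 1),
    β ^ (n - i) * gradientNoise ε R (fun l => gradient F (x l) c) (fun l => g l c) n i
  set S := ∑ j ∈ Finset.range N, (1 - β ^ (N - j)) * ‖gradient F (x j)‖ ^ 2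
  set Q := ∑ n ∈ Finset.range N, ‖u n‖ ^ 2
  set I := ∑ n ∈ Finset.range N, inner ℝ (gradient F (x n)) (u n)
  have hN := (h_below (x N)).trans (hdesc N)
  have hI : a * (Z + 1 / (2 * R * Real.sqrt N) * (1 / (1 - β) * S) -
      (d * (2 * R / (1 - β) ^ 2 * Λ) + (1 - β) / (4 * R) *
        (2 * β / (1 - β) ^ 3 * (L * a) ^ 2 * (1 / (1 - β) ^ 2 * (d * Λ))))) ≤ a * I := by
    refine mul_le_mul_of_nonneg_left ?_ ha0.le
    have h2 := mul_le_mul_of_nonneg_left (hdrift.trans (mul_le_mul_of_nonneg_left hu2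
      (show 0 ≤ 2 * β / (1 - β) ^ 3 * (L * a) ^ 2 by positivity)))
      (show 0 ≤ (1 - β) / (4 * R) by positivity)
    linarith
  have hQ : L / 2 * a ^ 2 * Q ≤ L / 2 * a ^ 2 * (1 / (1 - β) ^ 2 * (d * Λ)) :=
    mul_le_mul_of_nonneg_left hu2 (by positivity)
  have hS : a * (1 / (2 * R * Real.sqrt N) * (1 / (1 - β) * S)) =
      α / (2 * R * Real.sqrt N) * S := by
    rw [ha]
    field_simp
  have hcQ : L / 2 * a ^ 2 * (1 / (1 - β) ^ 2 * (d * Λ)) =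
      α / (2 * R) * (α * d * R * L) * Λ := by
    rw [ha]
    field_simp
  have hcU : a * (d * (2 * R / (1 - β) ^ 2 * Λ)) ≤
      α / (2 * R) * (12 * d * R ^ 2 / (1 - β)) * Λ := by
    have : α / (2 * R) * (12 * d * R ^ 2 / (1 - β)) * Λ =
        3 * (a * (d * (2 * R / (1 - β) ^ 2 * Λ))) := by
      rw [ha]
      field_simp
      ring
    have h3 : 0 ≤ a * (d * (2 * R / (1 - β) ^ 2 * Λ)) := by positivity
    linarith
  have hcD : a * ((1 - β) / (4 * R) *
      (2 * β / (1 - β) ^ 3 * (L * a) ^ 2 * (1 / (1 - β) ^ 2 * (d * Λ)))) ≤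
      α / (2 * R) * (2 * α ^ 2 * d * L ^ 2 * β / (1 - β)) * Λ := by
    have : α / (2 * R) * (2 * α ^ 2 * d * L ^ 2 * β / (1 - β)) * Λ =
        2 * (a * ((1 - β) / (4 * R) *
          (2 * β / (1 - β) ^ 3 * (L * a) ^ 2 * (1 / (1 - β) ^ 2 * (d * Λ))))) := by
      rw [ha]
      field_simp
      ring
    have h3 : 0 ≤ a * ((1 - β) / (4 * R) *
        (2 * β / (1 - β) ^ 3 * (L * a) ^ 2 * (1 / (1 - β) ^ 2 * (d * Λ)))) := by positivity
    linarith
  have hC : α / (2 * R) * adagradConst d α R L β * Λ =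
      α / (2 * R) * (α * d * R * L) * Λ + α / (2 * R) * (12 * d * R ^ 2 / (1 - β)) * Λ +
        α / (2 * R) * (2 * α ^ 2 * d * L ^ 2 * β / (1 - β)) * Λ := by
    rw [adagradConst]
    ring
  rw [hC]
  rw [mul_sub, mul_add, hS, mul_add] at hI
  linarith

/-! ### Closed form of the iteration -/

section Iteration

variable {d : ℕ} (β ε : ℝ) (a : ℕ → ℝ) (h : ℕ → EuclideanSpace ℝ (Fin d) → ℝ)
  (x₀ : EuclideanSpace ℝ (Fin d))

lemma adaState_v_eq_sqAcc (n : ℕ) (c : Fin d) :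
    (adaState β 1 ε a h x₀ n).v c =
      sqAcc (fun l => gradient (h l) (adaState β 1 ε a h x₀ l).x c) n := by
  induction n with
  | zero => simp [adaState, sqAcc]
  | succ n ih =>
    rw [sqAcc_succ, ← ih]
    simp [adaState, AdaState.step]

lemma adaState_m_succ_eq_momAcc (n : ℕ) (c : Fin d) :
    (adaState β 1 ε a h x₀ (n + 1)).m c =
      momAcc β (fun l => gradient (h l) (adaState β 1 ε a h x₀ l).x c) n := by
  induction n with
  | zero => simp [adaState, AdaState.step, momAcc]
  | succ n ih =>
    rw [momAcc_succ, ← ih]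
    simp [adaState, AdaState.step]

lemma adaState_x_succ (n : ℕ) :
    (adaState β 1 ε a h x₀ (n + 1)).x = (adaState β 1 ε a h x₀ n).x - a (n + 1) •
      WithLp.toLp 2 fun c => (adaState β 1 ε a h x₀ (n + 1)).m c /
        Real.sqrt (ε + (adaState β 1 ε a h x₀ (n + 1)).v c) := by
  ext c
  simp [adaState, AdaState.step]

end Iteration

/-! ### Measurability and independence -/

/-- The state after `n` steps is measurable for any σ-algebra that makes the first `n` samples
measurable. -/
lemma measurable_adaState {d : ℕ} {Ω Ξ : Type*} {mΩ : MeasurableSpace Ω} [MeasurableSpace Ξ]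
    {f : Ξ → EuclideanSpace ℝ (Fin d) → ℝ}
    (hf : Measurable fun p : Ξ × EuclideanSpace ℝ (Fin d) => gradient (f p.1) p.2)
    (β ε : ℝ) (a : ℕ → ℝ) (x₀ : EuclideanSpace ℝ (Fin d)) {ξ : ℕ → Ω → Ξ} (n : ℕ)
    (hξ : ∀ i < n, Measurable (ξ i)) :
    Measurable (fun ω => (adaState β 1 ε a (fun k => f (ξ k ω)) x₀ n).m) ∧
      Measurable (fun ω => (adaState β 1 ε a (fun k => f (ξ k ω)) x₀ n).v) ∧
      Measurable (fun ω => (adaState β 1 ε a (fun k => f (ξ k ω)) x₀ n).x) := by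
  induction n with
  | zero => exact ⟨measurable_const, measurable_const, measurable_const⟩
  | succ n ih =>
    obtain ⟨hm, hv, hx⟩ := ih fun i hi => hξ i (hi.trans n.lt_succ_self)
    have hg : Measurable fun ω => gradient (f (ξ n ω))
        (adaState β 1 ε a (fun k => f (ξ k ω)) x₀ n).x :=
      hf.comp ((hξ n n.lt_succ_self).prodMk hx)
    simp only [adaState, AdaState.step]
    refine ⟨?_, ?_, ?_⟩ <;>
    · refine (WithLp.measurable_toLp 2 _).comp (measurable_pi_lambda _ fun c => ?_)
      fun_prop

/-- The state after `n` steps only involves the samples before the `n`-th one, hence is independent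
of it. -/
lemma indepFun_adaState {d : ℕ} {Ω Ξ : Type*} [MeasurableSpace Ω] {P : Measure Ω}
    [MeasurableSpace Ξ] {f : Ξ → EuclideanSpace ℝ (Fin d) → ℝ}
    (hf : Measurable fun p : Ξ × EuclideanSpace ℝ (Fin d) => gradient (f p.1) p.2)
    (β ε : ℝ) (a : ℕ → ℝ) (x₀ : EuclideanSpace ℝ (Fin d)) {ξ : ℕ → Ω → Ξ}
    (hξ_meas : ∀ n, Measurable (ξ n)) (hξ_indep : iIndepFun ξ P) (n : ℕ) :
    IndepFun (fun ω => ((adaState β 1 ε a (fun k => f (ξ k ω)) x₀ n).x,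
      (adaState β 1 ε a (fun k => f (ξ k ω)) x₀ n).v)) (ξ n) P := by
  rw [IndepFun_iff_Indep]
  have hind := indep_iSup_of_disjoint (fun i => (hξ_meas i).comap_le) hξ_indep.iIndep
    (S := Set.Iio n) (T := {n}) (by simp)
  rw [iSup_singleton] at hind
  refine indep_of_indep_of_le_left hind (Measurable.comap_le ?_)
  obtain ⟨-, hv, hx⟩ := measurable_adaState
    (mΩ := ⨆ i ∈ Set.Iio n, MeasurableSpace.comap (ξ i) inferInstance) hf β ε a x₀ (ξ := ξ) n
    fun i hi => Measurable.of_comap_le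
      (le_iSup₂ (f := fun i (_ : i ∈ Set.Iio n) => MeasurableSpace.comap (ξ i) inferInstance) i hi)
  exact hx.prodMk hv

lemma ae_of_indepFun {Ω A Ξ : Type*} [MeasurableSpace Ω] {P : Measure Ω} [IsProbabilityMeasure P]
    [MeasurableSpace A] [MeasurableSpace Ξ] {X : Ω → A} {Y : Ω → Ξ} (hX : Measurable X)
    (hY : Measurable Y) (hXY : IndepFun X Y P) {p : A × Ξ → Prop} (hp : MeasurableSet {z | p z})
    (h : ∀ x, ∀ᵐ s ∂(P.map Y), p (x, s)) : ∀ᵐ ω ∂P, p (X ω, Y ω) := by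
  have := Measure.isProbabilityMeasure_map (μ := P) hY.aemeasurable
  have hprod : ∀ᵐ z ∂((P.map X).prod (P.map Y)), p z :=
    (Measure.ae_prod_iff_ae_ae hp).2 (Filter.Eventually.of_forall h)
  rw [← (indepFun_iff_map_prod_eq_prod_map_map hX.aemeasurable hY.aemeasurable).1 hXY] at hprod
  exact ae_of_ae_map (hX.prodMk hY).aemeasurable hprod

/-- A function of two independent variables that is centred in the second one, for each fixed value
of the first, is centred. Integrability is only needed under the joint law. -/
lemma integral_eq_zero_of_indepFun {Ω A Ξ : Type*} [MeasurableSpace Ω] {P : Measure Ω}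
    [IsProbabilityMeasure P] [MeasurableSpace A] [MeasurableSpace Ξ] {X : Ω → A} {Y : Ω → Ξ}
    (hX : Measurable X) (hY : Measurable Y) (hXY : IndepFun X Y P) {φ : A × Ξ → ℝ}
    (hφ : Measurable φ) (hint : Integrable (fun ω => φ (X ω, Y ω)) P)
    (h : ∀ x, ∫ s, φ (x, s) ∂(P.map Y) = 0) : ∫ ω, φ (X ω, Y ω) ∂P = 0 := by
  have := Measure.isProbabilityMeasure_map (μ := P) hX.aemeasurable
  have := Measure.isProbabilityMeasure_map (μ := P) hY.aemeasurable
  have hXYm := (hX.prodMk hY).aemeasurable (μ := P)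
  have hmap := (indepFun_iff_map_prod_eq_prod_map_map hX.aemeasurable hY.aemeasurable).1 hXY
  have hint' : Integrable φ ((P.map X).prod (P.map Y)) := by
    rw [← hmap]
    exact (integrable_map_measure hφ.aestronglyMeasurable hXYm).2 hint
  rw [← integral_map (f := φ) hXYm hφ.aestronglyMeasurable, hmap, integral_prod _ hint']
  simp [h]

/-- Expectation at an independent random index with finitely many values. -/
lemma integral_random_index {Ω : Type*} [MeasurableSpace Ω] {P : Measure Ω}
    [IsProbabilityMeasure P] {τ : Ω → ℕ} (hτ : Measurable τ) {N : ℕ} (hτ_lt : ∀ ω, τ ω < N)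
    {Y : ℕ → Ω → ℝ} (hY : ∀ j, Measurable (Y j)) (hY_int : ∀ j < N, Integrable (Y j) P)
    (hind : ∀ j, IndepFun τ (Y j) P) :
    Integrable (fun ω => Y (τ ω) ω) P ∧
      ∫ ω, Y (τ ω) ω ∂P = ∑ j ∈ Finset.range N, P.real {ω | τ ω = j} * ∫ ω, Y j ω ∂P := by
  have hset : ∀ j, MeasurableSet {ω | τ ω = j} := fun j => hτ (measurableSet_singleton j)
  have hdecomp : (fun ω => Y (τ ω) ω) =
      fun ω => ∑ j ∈ Finset.range N, Set.indicator {ω | τ ω = j} 1 ω * Y j ω := by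
    funext ω
    rw [Finset.sum_eq_single (τ ω)]
    · simp
    · intro j _ hj
      simp [hj.symm]
    · intro hj
      exact absurd (Finset.mem_range.2 (hτ_lt ω)) hj
  have hint : ∀ j ∈ Finset.range N,
      Integrable (fun ω => Set.indicator {ω | τ ω = j} 1 ω * Y j ω) P := by
    intro j hj
    refine ((hY_int j (Finset.mem_range.1 hj)).indicator (hset j)).congr
      (Filter.Eventually.of_forall fun ω => ?_)
    by_cases hω : τ ω = j <;> simp [hω]
  rw [hdecomp]
  refine ⟨integrable_finsetSum _ hint, ?_⟩
  rw [integral_finsetSum _ hint]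
  refine Finset.sum_congr rfl fun j _ => ?_
  have hj : IndepFun (fun ω => Set.indicator {ω | τ ω = j} (1 : Ω → ℝ) ω) (Y j) P :=
    (hind j).comp (φ := Set.indicator {j} (1 : ℕ → ℝ)) (ψ := id) (measurable_of_countable _)
      measurable_id
  rw [hj.integral_fun_mul_eq_mul_integral
    ((measurable_one.indicator (hset j)).aestronglyMeasurable) (hY j).aestronglyMeasurable]
  congr 1
  exact integral_indicator_one (hset j)

/-! ### The stochastic gradient -/

section StochasticGradient

variable {d : ℕ} {Ξ : Type*} [MeasurableSpace Ξ] {D : Measure Ξ} [IsProbabilityMeasure D]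
  {g : Ξ → EuclideanSpace ℝ (Fin d)} {B : ℝ}

lemma integrable_coord_of_bound (hg : Measurable g) (hB : ∀ᵐ s ∂D, ∀ i, |g s i| ≤ B)
    (c : Fin d) : Integrable (fun s => g s c) D :=
  Integrable.of_bound (by fun_prop) B (hB.mono fun _ hs => hs c)

lemma integral_coord_of_bound (hg : Measurable g) (hB : ∀ᵐ s ∂D, ∀ i, |g s i| ≤ B)
    (c : Fin d) : ∫ s, g s c ∂D = (∫ s, g s ∂D) c :=
  (eval_integral_piLp (integrable_coord_of_bound hg hB) c).symm

lemma abs_integral_coord_le (hg : Measurable g) (hB : ∀ᵐ s ∂D, ∀ i, |g s i| ≤ B)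
    (c : Fin d) : |(∫ s, g s ∂D) c| ≤ B := by
  rw [← integral_coord_of_bound hg hB c]
  simpa using norm_integral_le_of_norm_le_const (μ := D) (f := fun s => g s c) (C := B)
    (hB.mono fun _ hs => hs c)

end StochasticGradient

/-- Since the denominator of the noise is a function of the past, the noise has mean zero. -/
lemma integral_gradientNoise_eq_zero {d : ℕ} {Ω Ξ : Type*} [MeasurableSpace Ω] {P : Measure Ω}
    [IsProbabilityMeasure P] [MeasurableSpace Ξ] {D : Measure Ξ} {ξ : ℕ → Ω → Ξ}
    (hξ_meas : ∀ n, Measurable (ξ n)) (hξ_indep : iIndepFun ξ P) (hξ_law : ∀ n, P.map (ξ n) = D)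
    {f : Ξ → EuclideanSpace ℝ (Fin d) → ℝ} {F : EuclideanSpace ℝ (Fin d) → ℝ}
    (hf : Measurable fun p : Ξ × EuclideanSpace ℝ (Fin d) => gradient (f p.1) p.2)
    (hF : Measurable (gradient F))
    (h_unbiased : ∀ x, ∫ s, gradient (f s) x ∂D = gradient F x) {R ε : ℝ} (hε : 0 < ε)
    (h_bound : ∀ x, ∀ᵐ s ∂D, ∀ i, |gradient (f s) x i| ≤ R - Real.sqrt ε)
    (β : ℝ) (a : ℕ → ℝ) (x₀ : EuclideanSpace ℝ (Fin d))
    {x g : ℕ → Ω → EuclideanSpace ℝ (Fin d)}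
    (hx : x = fun n ω => (adaState β 1 ε a (fun k => f (ξ k ω)) x₀ n).x)
    (hg : g = fun n ω => gradient (f (ξ n ω)) (x n ω))
    (hgB : ∀ n, ∀ᵐ ω ∂P, ∀ c, |g n ω c| ≤ R - Real.sqrt ε) (n i : ℕ) (c : Fin d) :
    Integrable (fun ω => gradientNoise ε R (fun l => gradient F (x l ω) c) (fun l => g l ω c) n i)
        P ∧
      ∫ ω, gradientNoise ε R (fun l => gradient F (x l ω) c) (fun l => g l ω c) n i ∂P = 0 := by
  have hD : IsProbabilityMeasure D := by
    rw [← hξ_law 0]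
    exact Measure.isProbabilityMeasure_map (hξ_meas 0).aemeasurable
  have hfx : ∀ y, Measurable fun s => gradient (f s) y := fun y =>
    hf.comp (measurable_id.prodMk measurable_const)
  set B := R - Real.sqrt ε with hB
  obtain ⟨-, hv_meas, hx_meas⟩ := measurable_adaState hf β ε a x₀ i fun k _ => hξ_meas k
  let φ : (EuclideanSpace ℝ (Fin d) × EuclideanSpace ℝ (Fin d)) × Ξ → ℝ := fun z =>
    gradient F z.1.1 c * (gradient (f z.2) z.1.1 c - gradient F z.1.1 c) /
      Real.sqrt (ε + (z.1.2 c + ((n - i : ℕ) + 1) * B ^ 2))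
  have hφ : Measurable φ := by
    have h1 : Measurable fun z : (EuclideanSpace ℝ (Fin d) × EuclideanSpace ℝ (Fin d)) × Ξ =>
        gradient (f z.2) z.1.1 := hf.comp (measurable_snd.prodMk measurable_fst.fst)
    have h2 : Measurable fun z : (EuclideanSpace ℝ (Fin d) × EuclideanSpace ℝ (Fin d)) × Ξ =>
        gradient F z.1.1 := hF.comp measurable_fst.fst
    fun_prop
  have hXm := hx_meas.prodMk hv_meas
  have heq : (fun ω => gradientNoise ε R (fun l => gradient F (x l ω) c) (fun l => g l ω c) n i) =
      fun ω => φ (((adaState β 1 ε a (fun k => f (ξ k ω)) x₀ i).x,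
        (adaState β 1 ε a (fun k => f (ξ k ω)) x₀ i).v), ξ i ω) := by
    funext ω
    simp only [φ, gradientNoise, adaState_v_eq_sqAcc, hg, hx, hB]
  have hint : Integrable
      (fun ω => gradientNoise ε R (fun l => gradient F (x l ω) c) (fun l => g l ω c) n i) P := by
    refine Integrable.of_bound ?_ (B * (B + B) / Real.sqrt ε) ?_
    · rw [heq]
      exact (hφ.comp (hXm.prodMk (hξ_meas i))).aestronglyMeasurable
    · filter_upwards [hgB i] with ω hω
      have hG : |gradient F (x i ω) c| ≤ B := by
        rw [← h_unbiased]
        exact abs_integral_coord_le (hfx _) (h_bound _) c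
      have hB0 : 0 ≤ B := (abs_nonneg _).trans hG
      rw [gradientNoise, norm_div, Real.norm_of_nonneg (Real.sqrt_nonneg _), norm_mul]
      have hden : Real.sqrt ε ≤ Real.sqrt (ε + (sqAcc (fun l => g l ω c) i +
          ((n - i : ℕ) + 1) * B ^ 2)) := by
        refine Real.sqrt_le_sqrt ?_
        have h1 := sqAcc_nonneg (fun l => g l ω c) i
        have h2 : 0 ≤ (((n - i : ℕ) : ℝ) + 1) * B ^ 2 := by positivity
        linarith
      refine div_le_div₀ (by positivity) ?_ (Real.sqrt_pos.2 hε) hden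
      exact mul_le_mul hG ((norm_sub_le _ _).trans (add_le_add (hω c) hG)) (norm_nonneg _) hB0
  refine ⟨hint, ?_⟩
  rw [heq] at hint ⊢
  refine integral_eq_zero_of_indepFun hXm (hξ_meas i)
    (indepFun_adaState hf β ε a x₀ hξ_meas hξ_indep i) hφ hint fun z => ?_
  rw [hξ_law]
  simp only [φ]
  rw [integral_div, integral_const_mul,
    integral_sub (integrable_coord_of_bound (hfx _) (h_bound _) c) (integrable_const _),
    integral_coord_of_bound (hfx _) (h_bound _), h_unbiased]
  simp

/-! ### Convergence in expectation -/

theorem theorem3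
    {d : ℕ}
    -- the probability space, the space of samples, and the i.i.d. samples `ξ 0, ξ 1, …` of law `D`
    {Ω : Type*} [MeasurableSpace Ω] (P : Measure Ω) [IsProbabilityMeasure P]
    {Ξ : Type*} [MeasurableSpace Ξ] (D : Measure Ξ)
    (ξ : ℕ → Ω → Ξ) (hξ_meas : ∀ n, Measurable (ξ n)) (hξ_indep : iIndepFun ξ P)
    (hξ_law : ∀ n, P.map (ξ n) = D)
    -- the random function `f s`, `s` of law `D`, and the objective function `F`
    (f : Ξ → EuclideanSpace ℝ (Fin d) → ℝ) (F : EuclideanSpace ℝ (Fin d) → ℝ)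
    (hf_diff : ∀ x, ∀ᵐ s ∂D, DifferentiableAt ℝ (f s) x)
    (hf_meas : Measurable fun p : Ξ × EuclideanSpace ℝ (Fin d) => gradient (f p.1) p.2)
    (hF_diff : Differentiable ℝ F)
    (h_unbiased : ∀ x, ∫ s, gradient (f s) x ∂D = gradient F x)
    -- `F` is bounded below, stochastic gradients are bounded in `ℓ∞`, `∇F` is `L`-Lipschitz in `ℓ²`
    (Fstar R L ε : ℝ) (hε : 0 < ε) (hR : Real.sqrt ε ≤ R)
    (h_below : ∀ x, Fstar ≤ F x)
    (h_bound : ∀ x, ∀ᵐ s ∂D, ∀ i, |gradient (f s) x i| ≤ R - Real.sqrt ε)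
    (h_smooth : ∀ x y, ‖gradient F x - gradient F y‖ ≤ L * ‖x - y‖)
    -- the hyper-parameters and the number of iterations
    (α β₁ : ℝ) (hα : 0 < α) (hβ₁ : 0 ≤ β₁) (hβ₁' : β₁ < 1)
    (x₀ : EuclideanSpace ℝ (Fin d))
    (N : ℕ) (hN : β₁ / (1 - β₁) < (N : ℝ))
    -- the random index `τ`, independent of the samples
    (τ : Ω → ℕ) (hτ_meas : Measurable τ) (hτ_lt : ∀ ω, τ ω < N)
    (hτ_indep : IndepFun τ (fun ω n => ξ n ω) P)
    (hτ_law : ∃ c : ℝ, ∀ j < N, P.real {ω | τ ω = j} = c * (1 - β₁ ^ (N - j))) :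
    Integrable (fun ω =>
        ‖gradient F (adagradIterate β₁ ε α (fun n => f (ξ n ω)) x₀ (τ ω))‖ ^ 2) P ∧
      ∫ ω, ‖gradient F (adagradIterate β₁ ε α (fun n => f (ξ n ω)) x₀ (τ ω))‖ ^ 2 ∂P ≤
        2 * R * Real.sqrt N * ((F x₀ - Fstar) / (α * effectiveIterations N β₁)) +
          Real.sqrt N / effectiveIterations N β₁ * adagradConst d α R L β₁ *
            Real.log (1 + N * R ^ 2 / ε) ∧
      adagradConst d α R L β₁ ≤
        (α * d * R * L + 12 * d * R ^ 2 + 2 * α ^ 2 * d * L ^ 2) / (1 - β₁) := by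
  have hs : 0 < Real.sqrt ε := Real.sqrt_pos.2 hε
  have hR0 : 0 < R := hs.trans_le hR
  have h1 : 0 < 1 - β₁ := by linarith
  have hN0 : 0 < N := by
    have h2 : (0 : ℝ) < N := (div_nonneg hβ₁ h1.le).trans_lt hN
    exact_mod_cast h2
  have hNt : 0 < effectiveIterations N β₁ := sub_pos.2 hN
  have hD : IsProbabilityMeasure D := by
    rw [← hξ_law 0]
    exact Measure.isProbabilityMeasure_map (hξ_meas 0).aemeasurable
  have hfx : ∀ y, Measurable fun s => gradient (f s) y := fun y =>
    hf_meas.comp (measurable_id.prodMk measurable_const)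
  -- in dimension zero `L` may be negative, but then it does not contribute to the constant
  have hLabs : ∀ x y, ‖gradient F x - gradient F y‖ ≤ |L| * ‖x - y‖ := fun x y =>
    (h_smooth x y).trans (mul_le_mul_of_nonneg_right (le_abs_self L) (norm_nonneg _))
  have hdL : (d : ℝ) * |L| = d * L := by
    rcases Nat.eq_zero_or_pos d with rfl | hd
    · simp
    · have h2 := (norm_nonneg _).trans (h_smooth (EuclideanSpace.single ⟨0, hd⟩ 1) 0)
      rw [sub_zero, PiLp.norm_single, norm_one, mul_one] at h2
      rw [abs_of_nonneg h2]
  have hconst : adagradConst d α R |L| β₁ = adagradConst d α R L β₁ := by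
    rw [adagradConst, adagradConst, sq_abs]
    linear_combination α * R * hdL
  have hF_meas : Measurable (gradient F) :=
    (LipschitzWith.of_dist_le_mul (K := ⟨|L|, abs_nonneg L⟩) fun x y => by
      rw [dist_eq_norm, dist_eq_norm]
      exact hLabs x y).continuous.measurable
  have hGB : ∀ y c, |gradient F y c| ≤ R - Real.sqrt ε := fun y c => by
    rw [← h_unbiased]
    exact abs_integral_coord_le (hfx _) (h_bound _) c
  -- the trajectory and its stochastic gradients
  obtain ⟨x, hx⟩ : ∃ x : ℕ → Ω → EuclideanSpace ℝ (Fin d), x = fun n ω =>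
    (adaState β₁ 1 ε (fun _ => (1 - β₁) * α) (fun k => f (ξ k ω)) x₀ n).x := ⟨_, rfl⟩
  obtain ⟨g, hg⟩ : ∃ g : ℕ → Ω → EuclideanSpace ℝ (Fin d), g = fun n ω =>
    gradient (f (ξ n ω)) (x n ω) := ⟨_, rfl⟩
  have hx_meas : ∀ n, Measurable (x n) := fun n => by
    rw [hx]
    exact (measurable_adaState hf_meas β₁ ε _ x₀ n fun k _ => hξ_meas k).2.2
  have hgB : ∀ n, ∀ᵐ ω ∂P, ∀ c, |g n ω c| ≤ R - Real.sqrt ε := by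
    intro n
    have hind : IndepFun (x n) (ξ n) P := by
      rw [hx]
      exact (indepFun_adaState hf_meas β₁ ε _ x₀ hξ_meas hξ_indep n).comp measurable_fst
        measurable_id
    have hp : MeasurableSet {z : EuclideanSpace ℝ (Fin d) × Ξ |
        ∀ c, |gradient (f z.2) z.1 c| ≤ R - Real.sqrt ε} := by
      have hm : Measurable fun z : EuclideanSpace ℝ (Fin d) × Ξ => gradient (f z.2) z.1 :=
        hf_meas.comp measurable_swap
      have hset : {z : EuclideanSpace ℝ (Fin d) × Ξ |
          ∀ c, |gradient (f z.2) z.1 c| ≤ R - Real.sqrt ε} =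
          ⋂ c, {z | |gradient (f z.2) z.1 c| ≤ R - Real.sqrt ε} := by
        ext z
        simp
      rw [hset]
      refine MeasurableSet.iInter fun c => measurableSet_le ?_ measurable_const
      have hc : Measurable fun z : EuclideanSpace ℝ (Fin d) × Ξ => gradient (f z.2) z.1 c := by
        fun_prop
      exact continuous_abs.measurable.comp hc
    have h2 := ae_of_indepFun (hx_meas n) (hξ_meas n) hind hp fun y => by
      rw [hξ_law]
      exact h_bound y
    rw [hg]
    exact h2
  have hnoise := integral_gradientNoise_eq_zero hξ_meas hξ_indep hξ_law hf_meas hF_meas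
    h_unbiased hε h_bound β₁ _ x₀ hx hg hgB
  -- squared gradient norms along the trajectory
  have hY_meas : ∀ j, Measurable fun ω => ‖gradient F (x j ω)‖ ^ 2 := fun j =>
    (hF_meas.comp (hx_meas j)).norm.pow_const 2
  have hY_int : ∀ j, Integrable (fun ω => ‖gradient F (x j ω)‖ ^ 2) P := by
    intro j
    refine Integrable.of_bound (hY_meas j).aestronglyMeasurable
      (∑ _c : Fin d, (R - Real.sqrt ε) ^ 2) (Filter.Eventually.of_forall fun ω => ?_)
    rw [Real.norm_of_nonneg (sq_nonneg _), EuclideanSpace.real_norm_sq_eq]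
    exact Finset.sum_le_sum fun c _ => sq_le_sq' (abs_le.1 (hGB _ c)).1 (abs_le.1 (hGB _ c)).2
  set K := F x₀ - Fstar +
    α / (2 * R) * adagradConst d α R L β₁ * Real.log (1 + N * R ^ 2 / ε) with hK
  have hpath : ∀ᵐ ω ∂P, α / (2 * R * Real.sqrt N) *
        ∑ j ∈ Finset.range N, (1 - β₁ ^ (N - j)) * ‖gradient F (x j ω)‖ ^ 2 +
      (1 - β₁) * α * ∑ c, ∑ n ∈ Finset.range N, ∑ i ∈ Finset.range (n + 1), β₁ ^ (n - i) *
        gradientNoise ε R (fun l => gradient F (x l ω) c) (fun l => g l ω c) n i ≤ K := by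
    filter_upwards [ae_all_iff.2 hgB] with ω hω
    have h2 := pathwise_bound hF_diff hε hR (abs_nonneg L) h_below hLabs hα hβ₁ hβ₁'
      (N := N) (x := fun n => x n ω) (g := fun n => g n ω)
      (u := fun n => WithLp.toLp 2 fun c =>
        (adaState β₁ 1 ε (fun _ => (1 - β₁) * α) (fun k => f (ξ k ω)) x₀ (n + 1)).m c /
        Real.sqrt (ε +
          (adaState β₁ 1 ε (fun _ => (1 - β₁) * α) (fun k => f (ξ k ω)) x₀ (n + 1)).v c))
      (fun n _ => hω n)
      (fun n c => by
        simp only [adaState_m_succ_eq_momAcc, adaState_v_eq_sqAcc, hg, hx])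
      (fun n => by
        simp only [hx]
        exact adaState_x_succ _ _ _ _ _ n)
    rw [hconst, show x 0 ω = x₀ by rw [hx]; rfl] at h2
    exact h2
  have hS_int : Integrable (fun ω =>
      ∑ j ∈ Finset.range N, (1 - β₁ ^ (N - j)) * ‖gradient F (x j ω)‖ ^ 2) P :=
    integrable_finsetSum _ fun j _ => (hY_int j).const_mul _
  have hZ_term : ∀ c n i, Integrable (fun ω => β₁ ^ (n - i) *
      gradientNoise ε R (fun l => gradient F (x l ω) c) (fun l => g l ω c) n i) P :=
    fun c n i => (hnoise n i c).1.const_mul _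
  have hZ_int : Integrable (fun ω => ∑ c, ∑ n ∈ Finset.range N, ∑ i ∈ Finset.range (n + 1),
      β₁ ^ (n - i) *
        gradientNoise ε R (fun l => gradient F (x l ω) c) (fun l => g l ω c) n i) P :=
    integrable_finsetSum _ fun c _ => integrable_finsetSum _ fun n _ =>
      integrable_finsetSum _ fun i _ => hZ_term c n i
  have hZ_zero : ∫ ω, ∑ c, ∑ n ∈ Finset.range N, ∑ i ∈ Finset.range (n + 1),
      β₁ ^ (n - i) *
        gradientNoise ε R (fun l => gradient F (x l ω) c) (fun l => g l ω c) n i ∂P = 0 := by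
    rw [integral_finsetSum _ fun c _ => integrable_finsetSum _ fun n _ =>
      integrable_finsetSum _ fun i _ => hZ_term c n i]
    refine Finset.sum_eq_zero fun c _ => ?_
    rw [integral_finsetSum _ fun n _ => integrable_finsetSum _ fun i _ => hZ_term c n i]
    refine Finset.sum_eq_zero fun n _ => ?_
    rw [integral_finsetSum _ fun i _ => hZ_term c n i]
    refine Finset.sum_eq_zero fun i _ => ?_
    rw [integral_const_mul, (hnoise n i c).2, mul_zero]
  have hmean : α / (2 * R * Real.sqrt N) *
      ∑ j ∈ Finset.range N, (1 - β₁ ^ (N - j)) * ∫ ω, ‖gradient F (x j ω)‖ ^ 2 ∂P ≤ K := by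
    have h2 := integral_mono_ae ((hS_int.const_mul _).add (hZ_int.const_mul _))
      (integrable_const K) hpath
    simp only [Pi.add_apply] at h2
    rw [integral_add (hS_int.const_mul _) (hZ_int.const_mul _), integral_const_mul,
      integral_const_mul, hZ_zero, mul_zero, add_zero,
      integral_finsetSum _ fun j _ => (hY_int j).const_mul _] at h2
    simpa [integral_const_mul] using h2
  -- the random index
  have hτ_ind : ∀ j, IndepFun τ (fun ω => ‖gradient F (x j ω)‖ ^ 2) P := by
    intro j
    have hm := (measurable_adaState hf_meas β₁ ε (fun _ => (1 - β₁) * α) x₀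
      (ξ := fun k (z : ℕ → Ξ) => z k) j fun k _ => measurable_pi_apply k).2.2
    have h2 := hτ_indep.comp measurable_id ((hF_meas.comp hm).norm.pow_const 2)
    rw [hx]
    exact h2
  obtain ⟨hτ_int, hτ_eq⟩ := integral_random_index hτ_meas hτ_lt hY_meas (fun j _ => hY_int j)
    hτ_ind
  obtain ⟨-, hτ_one⟩ := integral_random_index (P := P) hτ_meas hτ_lt
    (Y := fun _ _ => (1 : ℝ)) (fun _ => measurable_const) (fun _ _ => integrable_const _)
    fun _ => indepFun_const_right _ _
  obtain ⟨c, hc⟩ := hτ_law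
  have hgoal : (fun ω => ‖gradient F (adagradIterate β₁ ε α (fun n => f (ξ n ω)) x₀ (τ ω))‖ ^ 2) =
      fun ω => ‖gradient F (x (τ ω) ω)‖ ^ 2 := by
    rw [hx]
    rfl
  rw [hgoal]
  refine ⟨hτ_int, ?_, ?_⟩
  · set S := ∑ j ∈ Finset.range N, (1 - β₁ ^ (N - j)) with hS
    have hcS : c * S = 1 := by
      simp only [integral_const, probReal_univ, smul_eq_mul, mul_one] at hτ_one
      rw [hτ_one, hS, Finset.mul_sum]
      exact Finset.sum_congr rfl fun j hj => (hc j (Finset.mem_range.1 hj)).symm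
    have hSN : effectiveIterations N β₁ ≤ S := by
      have h2 : S = N - ∑ k ∈ Finset.range N, β₁ ^ (k + 1) := by
        rw [hS, Finset.sum_sub_distrib, ← Finset.sum_range_reflect (fun k => β₁ ^ (k + 1)) N]
        simp only [Finset.sum_const, Finset.card_range, nsmul_eq_mul, mul_one]
        congr 1
        refine Finset.sum_congr rfl fun j hj => ?_
        rw [Finset.mem_range] at hj
        rw [show N - 1 - j + 1 = N - j by omega]
      have h3 : ∑ k ∈ Finset.range N, β₁ ^ (k + 1) ≤ β₁ / (1 - β₁) := by
        simp_rw [pow_succ]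
        rw [← Finset.sum_mul]
        calc _ ≤ 1 / (1 - β₁) * β₁ :=
              mul_le_mul_of_nonneg_right (sum_geometric_le hβ₁ hβ₁' N) hβ₁
          _ = _ := by ring
      rw [h2, effectiveIterations]
      linarith
    have hc0 : 0 ≤ c := by
      have hS0 := hNt.trans_le hSN
      exact (pos_of_mul_pos_left (hcS ▸ one_pos) hS0.le).le
    set T := ∑ j ∈ Finset.range N, (1 - β₁ ^ (N - j)) * ∫ ω, ‖gradient F (x j ω)‖ ^ 2 ∂P with hT
    have hT0 : 0 ≤ T := Finset.sum_nonneg fun j _ => mul_nonneg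
      (sub_nonneg.2 (pow_le_one₀ hβ₁ hβ₁'.le)) (integral_nonneg fun _ => sq_nonneg _)
    have hτT : ∫ ω, ‖gradient F (x (τ ω) ω)‖ ^ 2 ∂P = c * T := by
      rw [hτ_eq, hT, Finset.mul_sum]
      refine Finset.sum_congr rfl fun j hj => ?_
      rw [hc j (Finset.mem_range.1 hj)]
      ring
    have hsN : 0 < Real.sqrt N := Real.sqrt_pos.2 (by exact_mod_cast hN0)
    have hTK : T ≤ 2 * R * Real.sqrt N / α * K := by
      calc T = 2 * R * Real.sqrt N / α * (α / (2 * R * Real.sqrt N) * T) := by field_simp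
        _ ≤ _ := mul_le_mul_of_nonneg_left hmean (by positivity)
    have hcN : c * T ≤ T / effectiveIterations N β₁ := by
      rw [le_div_iff₀ hNt]
      calc c * T * effectiveIterations N β₁ ≤ c * T * S :=
            mul_le_mul_of_nonneg_left hSN (mul_nonneg hc0 hT0)
        _ = c * S * T := by ring
        _ = T := by rw [hcS, one_mul]
    rw [hτT]
    refine (hcN.trans (div_le_div_of_nonneg_right hTK hNt.le)).trans_eq ?_
    rw [hK]
    field_simp
  · have hdL0 : 0 ≤ (d : ℝ) * L := by
      rw [← hdL]
      positivity
    have h2 : 0 ≤ α * d * R * L := by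
      have : α * d * R * L = α * R * (d * L) := by ring
      rw [this]
      positivity
    rw [adagradConst, add_div, add_div]
    have h3 : α * d * R * L ≤ α * d * R * L / (1 - β₁) := le_div_self h2 h1 (by linarith)
    have h4 : 2 * α ^ 2 * d * L ^ 2 * β₁ / (1 - β₁) ≤ 2 * α ^ 2 * d * L ^ 2 / (1 - β₁) :=
      div_le_div_of_nonneg_right (mul_le_of_le_one_right (by positivity) hβ₁'.le) h1.le
    linarith
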